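/- Let $G$ be a finite group of order $n$, let $\xi\in\mathbb{C}$ be a primitive $n$-th root of unity, let $R(G)$ be the representation ring of $G$ (the ring of $\mathbb{Z}$-linear combinations of the irreducible complex characters of $G$ under pointwise operations), and set $C=\operatorname{Spec}(\mathbb{Z}[\xi]\otimes_{\mathbb{Z}}R(G))$. For a point $P$ of a scheme $X$ over $Y$, let $\mathcal{O}_P$ be the local ring of $X$ at $P$, with maximal ideal $\mathfrak{m}_P$ and residue field $k_P$; let $T_P(X/Y)=\operatorname{Hom}_{k_P}(\Omega_{X/Y}\otimes k_P,k_P)$ be the Zariski tangent space of $X/Y$ at $P$, where $\Omega_{X/Y}$ is the sheaf of differentials, and let $\operatorname{edim}_P(X)=\dim_{k_P}(\mathfrak{m}_P/\mathfrak{m}_P^2)$. Write $T_P(X/A)$ for $T_P(X/\operatorname{Spec}A)$. Let $P\in C$ be a point, regarded as a prime ideal of $\mathbb{Z}[\xi]\otimes_{\mathbb{Z}}R(G)$, and let $p$ be a prime number with $p\in P$. Then $T_P(C/\mathbb{Z}[\xi])$, $T_P(C/\mathbb{Z})$ and $\mathfrak{m}_P/\mathfrak{m}_P^2$ are finite-dimensional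 over $k_P$, and the following hold. (i) If $p\mid n$ and either $p\neq 2$ or $4\mid n$, then $$\dim_{k_P}T_P(C/\mathbb{Z}[\xi])+1=\dim_{k_P}T_P(C/\mathbb{Z})=\operatorname{edim}_P(C).$$ (ii) If $p\nmid n$, or $p=2$ and $4\nmid n$, then $$\dim_{k_P}T_P(C/\mathbb{Z}[\xi])=\dim_{k_P}T_P(C/\mathbb{Z})=\operatorname{edim}_P(C)-1.$$ Furthermore, the condition of case (i) holds if and only if $p\in P^2$. -/

import Mathlib

open scoped TensorProduct

/-- The set of irreducible complex characters of `G`. Every finite-dimensional complex vector space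
is isomorphic to some `ℂ ^ d`, so it is enough to let `G` act on these. -/
def irreducibleCharacters (G : Type*) [Group G] : Set (G → ℂ) :=
  {χ | ∃ (d : ℕ) (ρ : Representation ℂ G (Fin d → ℂ)), ρ.IsIrreducible ∧ ρ.character = χ}

/-- The character of any finite-dimensional complex representation of a finite group is a
`ℤ`-linear combination of irreducible characters. -/
theorem character_mem_closure_irreducibleCharacters {G : Type*} [Group G] [Finite G] (m : ℕ) :
    ∀ {V : Type} [AddCommGroup V] [Module ℂ V] [FiniteDimensional ℂ V]
      (ρ : Representation ℂ G V), Module.finrank ℂ V = m →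
      ρ.character ∈ AddSubgroup.closure (irreducibleCharacters G) := by
  induction m using Nat.strong_induction_on with
  | _ m ih =>
    intro V _ _ _ ρ hm
    let e : V ≃ₗ[ℂ] (Fin m → ℂ) :=
      LinearEquiv.ofFinrankEq V (Fin m → ℂ) (by simp [hm])
    let σ : Representation ℂ G (Fin m → ℂ) :=
      { toFun := fun g => e.conj (ρ g)
        map_one' := by ext; simp
        map_mul' := fun x y => by ext; simp [LinearEquiv.conj_apply] }
    have hσ : ρ.character = σ.character := by
      funext g
      exact (LinearMap.trace_conj' (ρ g) e).symm
    rw [hσ]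
    by_cases hirr : σ.IsIrreducible
    · exact AddSubgroup.subset_closure ⟨m, σ, hirr, rfl⟩
    by_cases hnt : Nontrivial (Subrepresentation σ)
    · have hex : ∃ a : Subrepresentation σ, a ≠ ⊥ ∧ a ≠ ⊤ := by
        by_contra hcon
        push Not at hcon
        exact hirr ⟨fun a => or_iff_not_imp_left.mpr (hcon a)⟩
      obtain ⟨a, ha0, ha1⟩ := hex
      obtain ⟨b, hab⟩ := exists_isCompl a
      have hab' : IsCompl a.toSubmodule b.toSubmodule := by
        refine ⟨disjoint_iff.mpr ?_, codisjoint_iff.mpr ?_⟩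
        · exact congrArg Subrepresentation.toSubmodule hab.inf_eq_bot
        · exact congrArg Subrepresentation.toSubmodule hab.sup_eq_top
      have hb1 : b ≠ ⊤ := by
        rintro rfl
        exact ha0 (by simpa using hab.inf_eq_bot)
      have hlt : ∀ c : Subrepresentation σ, c ≠ ⊤ → Module.finrank ℂ c.toSubmodule < m := by
        intro c hc
        have hc' : c.toSubmodule ≠ ⊤ := fun h =>
          hc (Subrepresentation.toSubmodule_injective h)
        have := Submodule.finrank_lt hc'
        simpa using this
      have hsum : σ.character = a.toRepresentation.character + b.toRepresentation.character := by
        funext g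
        have hint : DirectSum.IsInternal
            (fun i : Bool => cond i a.toSubmodule b.toSubmodule) :=
          (DirectSum.isInternal_submodule_iff_isCompl _ (i := true) (j := false) (by simp)
            (by ext i; cases i <;> simp)).mpr hab'
        have hmaps : ∀ i : Bool, Set.MapsTo (σ g)
            (cond i a.toSubmodule b.toSubmodule : Submodule ℂ (Fin m → ℂ))
            (cond i a.toSubmodule b.toSubmodule : Submodule ℂ (Fin m → ℂ)) := by
          intro i
          cases i
          · exact fun v hv => b.apply_mem_toSubmodule g hv
          · exact fun v hv => a.apply_mem_toSubmodule g hv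
        have h := LinearMap.trace_eq_sum_trace_restrict hint hmaps
        rw [Fintype.sum_bool] at h
        exact h
      rw [hsum]
      exact add_mem (ih _ (hlt a ha1) a.toRepresentation rfl)
        (ih _ (hlt b hb1) b.toRepresentation rfl)
    · have hsub : Subsingleton (Fin m → ℂ) := by
        rw [not_nontrivial_iff_subsingleton] at hnt
        have h : (⊥ : Submodule ℂ (Fin m → ℂ)) = ⊤ :=
          congrArg Subrepresentation.toSubmodule (Subsingleton.elim (⊥ : Subrepresentation σ) ⊤)
        exact (Submodule.subsingleton_iff ℂ).mp (subsingleton_of_bot_eq_top h)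
      have h0 : σ.character = 0 := by
        funext g
        have : σ g = 0 := LinearMap.ext fun v => Subsingleton.elim _ _
        simp [Representation.character, this]
      rw [h0]
      exact zero_mem _

/-- The representation ring `R(G)` of a finite group: the `ℤ`-linear combinations of the
irreducible complex characters of `G`, with pointwise addition and multiplication. -/
noncomputable def representationRing (G : Type*) [Group G] [Finite G] : Subring (G → ℂ) :=
  { AddSubgroup.closure (irreducibleCharacters G) with
    one_mem' := by
      have h : (Representation.trivial ℂ G ℂ).character = 1 := by
        funext g
        simp [Representation.character, Representation.trivial]
      have h' := character_mem_closure_irreducibleCharacters _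
        (Representation.trivial ℂ G ℂ) rfl
      rwa [h] at h'
    mul_mem' := by
      intro x y hx hy
      refine AddSubgroup.closure_induction₂ (p := fun x y _ _ =>
        x * y ∈ AddSubgroup.closure (irreducibleCharacters G)) ?_ ?_ ?_ ?_ ?_ ?_ ?_ hx hy
      · rintro _ _ ⟨d, ρ, -, rfl⟩ ⟨d', ρ', -, rfl⟩
        rw [← Representation.char_tensor]
        exact character_mem_closure_irreducibleCharacters _ (ρ.tprod ρ') rfl
      · intro x _
        simp
      · intro x _
        simp
      · intro x y z _ _ _ h1 h2
        rw [add_mul]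
        exact add_mem h1 h2
      · intro x y z _ _ _ h1 h2
        rw [mul_add]
        exact add_mem h1 h2
      · intro x y _ _ h
        rw [neg_mul]
        exact neg_mem h
      · intro x y _ _ h
        rw [mul_neg]
        exact neg_mem h }

/-- The ring `ℤ[ξ] ⊗ R(G)`, where `ℤ[ξ]` is the subring of `ℂ` generated by `ξ`. It is a
`ℤ[ξ]`-algebra through the left factor. -/
abbrev extendedRepresentationRing (G : Type*) [Group G] [Finite G] (ξ : ℂ) : Type _ :=
  (Algebra.adjoin ℤ {ξ} : Subalgebra ℤ ℂ) ⊗[ℤ] (representationRing G)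

/-- The Zariski tangent space `T_P(X/Y) = Hom_{k_P}(Ω_{X/Y} ⊗ k_P, k_P)` at a point `P` of
`X = Spec R` over `Y = Spec A`. Here the sheaf of differentials `Ω_{X/Y}` is the quasi-coherent
sheaf associated with the `R`-module of Kähler differentials of `R` over `A`, so that its fibre
at `P` is `k_P ⊗[R] Ω[R⁄A]`, and `k_P` is the residue field of the local ring of `X` at `P`. -/
abbrev ZariskiTangentSpace (A : Type*) {R : Type*} [CommRing A] [CommRing R] [Algebra A R]
    (P : PrimeSpectrum R) : Type _ :=
  Module.Dual P.asIdeal.ResidueField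
    (P.asIdeal.ResidueField ⊗[R] KaehlerDifferential A R)

/-- The cotangent space `𝔪_P / 𝔪_P²` of the local ring of `Spec R` at `P`; the embedding dimension
of `Spec R` at `P` is its dimension over the residue field. -/
abbrev localCotangentSpace {R : Type*} [CommRing R] (P : PrimeSpectrum R) : Type _ :=
  IsLocalRing.CotangentSpace (Localization.AtPrime P.asIdeal)

/-- The embedding dimension of `Spec R` at `P`, that is `dim_{k_P} (𝔪_P / 𝔪_P²)`. -/
noncomputable def embeddingDimension {R : Type*} [CommRing R] (P : PrimeSpectrum R) : ℕ :=
  Module.finrank P.asIdeal.ResidueField (localCotangentSpace P)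

/-! The residue field `k` of `P` is finite, say with `q` elements, and a derivation `D` into `k`
kills every `b ^ q`. Hence `D b = D (b - b ^ q)` with `b - b ^ q ∈ P`, so `D` is known from the
functional it induces on `P / P ^ 2`. Conversely, a functional extends to a derivation over the base
`A` exactly when it kills the classes of the elements of `A` lying in `P`. If these classes span a
line or zero, the tangent space over `A` has dimension one less than `edim`, or equal to it
(`finrank_derivation_add`).

Over `ℤ` the span is generated by the class of `p`; over `ℤ[ξ]`, by that of a uniformizer `x` of the
prime `𝔭` below `P`. Evaluation of characters embeds `ℤ[ξ] ⊗ R(G)` in `ℤ[ξ] ^ G`, so by lying over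
`P` is the inverse image of `𝔭` under evaluation at some group element. This evaluation is a
retraction onto `ℤ[ξ]`, whence `P ^ 2` meets `ℤ[ξ]` in `𝔭 ^ 2`. So `x ∉ P ^ 2` always, while `p ∈ P
^ 2` iff `p ∈ 𝔭 ^ 2`, that is, iff `p` ramifies in `ℤ[ξ]`.

Ramification is decided by roots of unity: if `μ` has order an odd prime `p`, or order `4` with `p =
2`, then `(μ - 1) ^ 2` divides `p`. In the remaining cases `ξ ^ m = ±1` with `p ∤ m`; then `ℤ[ξ]`
has no nonzero derivation into the residue field, and the dimension count over `ℤ` excludes `p ∈ 𝔭 ^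
2`. -/

/-- A derivation with values in a finite residue field is determined by its restriction to the
kernel of the residue map, and any functional on the cotangent space killing the image of the base
ring extends: `b ↦ ψ (b - b ^ q)`. -/
theorem exists_cotangent_equiv_derivation {A R K V : Type*} [CommRing A] [CommRing R] [Algebra A R]
    [Field K] [Finite K] [Algebra R K] [Algebra A K] [IsScalarTower A R K]
    [AddCommGroup V] [Module K V] [Module R V] [IsScalarTower R K V]
    (hK : Function.Surjective (algebraMap R K))
    {P : Ideal R} (hP : RingHom.ker (algebraMap R K) = P)
    (Φ : P →ₗ[R] V) (hΦ : Function.Surjective Φ) (hker : ∀ y : P, Φ y = 0 ↔ (y : R) ∈ P ^ 2)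
    {v : V} (hv : ∀ (a : A) (ha : algebraMap A R a ∈ P), ∃ c : K, Φ ⟨_, ha⟩ = c • v)
    {a₀ : A} (ha₀ : algebraMap A R a₀ ∈ P) (hav : Φ ⟨_, ha₀⟩ = v) :
    Nonempty ((Submodule.span K {v}).dualAnnihilator ≃ₗ[K] Derivation A R K) := by
  have : Fintype K := Fintype.ofFinite K
  obtain ⟨p, hpK⟩ := CharP.exists K
  obtain ⟨f, hp, hq⟩ := FiniteField.card K p
  set q := p ^ (f : ℕ) with hqdef
  have hf : (f : ℕ) ≠ 0 := f.ne_zero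
  have hq2 : 2 ≤ q := hp.two_le.trans (Nat.le_self_pow hf p)
  have hfrob (c : K) : c ^ q = c := hq ▸ FiniteField.pow_card c
  have hmem (x : R) : x ∈ P ↔ algebraMap R K x = 0 := by rw [← hP, RingHom.mem_ker]
  have hpP : algebraMap A R (p : A) ∈ P := by simp [hmem]
  have hsub (b : R) : b - b ^ q ∈ P := by simp [hmem, hfrob]
  have hqK : (q : K) = 0 := by simp [hqdef, hf]
  let θ (b : R) : V := Φ ⟨b - b ^ q, hsub b⟩
  have hθP (y : P) : θ y = Φ y := by
    have h : (⟨(y : R) - (y : R) ^ q, hsub y⟩ : P) - y = ⟨-(y : R) ^ q, by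
        simpa using P.pow_mem_of_mem y.2 q (by omega)⟩ := by
      ext; simp
    rw [← sub_eq_zero]
    change Φ _ - Φ _ = 0
    rw [← map_sub, h, hker]
    -- On `P` the correction `y ^ q` lies in `P ^ 2` because `q ≥ 2`.
    exact neg_mem (Ideal.pow_le_pow_right hq2 (Ideal.pow_mem_pow y.2 q))
  have hmod (ψ : V →ₗ[K] K) (r : R) (w : V) : ψ (r • w) = algebraMap R K r * ψ w := by
    rw [← IsScalarTower.algebraMap_smul K r w, map_smul, smul_eq_mul]
  let S := (Submodule.span K {v}).dualAnnihilator
  have hS (ψ : S) : ψ.1 v = 0 :=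
    (Submodule.mem_dualAnnihilator _).1 ψ.2 v (Submodule.mem_span_singleton_self v)
  have hSA (ψ : S) (a : A) (ha : algebraMap A R a ∈ P) : ψ.1 (Φ ⟨_, ha⟩) = 0 := by
    obtain ⟨c, hc⟩ := hv a ha
    rw [hc, map_smul, hS, smul_zero]
  have hmul (ψ : S) (a b : R) : ψ.1 (θ (a * b)) = a • ψ.1 (θ b) + b • ψ.1 (θ a) := by
    -- Leibniz rule: `b ^ q` acts on `K` as `b`.
    have h : (⟨a * b - (a * b) ^ q, hsub _⟩ : P) =
        a • (⟨b - b ^ q, hsub b⟩ : P) + (b ^ q) • (⟨a - a ^ q, hsub a⟩ : P) := by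
      ext; simp; ring
    change ψ.1 (Φ _) = _
    rw [h, map_add, map_smul, map_smul, map_add, hmod, hmod, map_pow, hfrob, Algebra.smul_def,
      Algebra.smul_def]
  have hadd (ψ : S) (a b : R) : ψ.1 (θ (a + b)) = ψ.1 (θ a) + ψ.1 (θ b) := by
    -- The failure of `b ↦ b ^ q` to be additive is a multiple of `p`. Since `p` comes from `A`, its
    -- class is killed by `ψ`.
    obtain ⟨r, hr⟩ := exists_add_pow_prime_pow_eq hp a b f
    have h : (⟨a + b - (a + b) ^ q, hsub _⟩ : P) =
        (⟨a - a ^ q, hsub a⟩ : P) + (⟨b - b ^ q, hsub b⟩ : P) -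
          (a * b * r) • (⟨algebraMap A R (p : A), hpP⟩ : P) := by
      ext; simp [hqdef, hr]; ring
    change ψ.1 (Φ _) = _
    rw [h, map_sub, map_sub, map_smul, hmod, hSA, mul_zero, sub_zero, map_add, map_add]
  have hA (ψ : S) (a : A) : ψ.1 (θ (algebraMap A R a)) = 0 := by
    have h := hSA ψ (a - a ^ q) (by simpa using hsub (algebraMap A R a))
    simpa [θ] using h
  let L : S →ₗ[K] Derivation A R K :=
    { toFun := fun ψ => Derivation.mk'
        { toFun := fun b => ψ.1 (θ b)
          map_add' := hadd ψ
          map_smul' := fun a b => by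
            rw [Algebra.smul_def, hmul, hA, smul_zero, add_zero, RingHom.id_apply,
              algebraMap_smul] } (hmul ψ)
      map_add' := fun ψ ψ' => by ext; simp
      map_smul' := fun c ψ => by ext; simp }
  have hL (ψ : S) (b : R) : L ψ b = ψ.1 (θ b) := rfl
  refine ⟨LinearEquiv.ofBijective L ⟨?_, ?_⟩⟩
  · intro ψ ψ' hψ
    ext w
    obtain ⟨y, rfl⟩ := hΦ w
    rw [← hθP, ← hL, ← hL, hψ]
  · intro D
    let g : P →ₗ[R] K :=
      { toFun := fun y => D y
        map_add' := fun x y => by simp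
        map_smul' := fun r y => by
          have : algebraMap R K y = 0 := (hmem _).1 y.2
          simp [Algebra.smul_def, this] }
    have hg : ∀ y : R, y ∈ P ^ 2 → D y = 0 := by
      intro y hy
      rw [pow_two] at hy
      refine Submodule.mul_induction_on hy ?_ ?_
      · intro a ha b hb
        rw [Derivation.leibniz, Algebra.smul_def, Algebra.smul_def, (hmem _).1 ha, (hmem _).1 hb]
        simp
      · intro a b ha hb
        rw [map_add, ha, hb, add_zero]
    let e := Φ.quotKerEquivOfSurjective hΦ
    let g' : V →ₗ[R] K := ((LinearMap.ker Φ).liftQ g (fun y hy => hg _ ((hker y).1 hy))) ∘ₗ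
      e.symm.toLinearMap
    have hg' (y : P) : g' (Φ y) = D y := by
      have : e.symm (Φ y) = Submodule.Quotient.mk y := by
        rw [LinearEquiv.symm_apply_eq]; rfl
      simp only [g', LinearMap.comp_apply, LinearEquiv.coe_coe, this]
      rfl
    let ψ : V →ₗ[K] K := LinearMap.extendScalarsOfSurjective hK g'
    have hψ (y : P) : ψ (Φ y) = D y := hg' y
    have hψS : ψ ∈ S := by
      rw [Submodule.mem_dualAnnihilator]
      intro w hw
      obtain ⟨c, rfl⟩ := Submodule.mem_span_singleton.1 hw
      rw [map_smul, ← hav, hψ, Derivation.map_algebraMap, smul_zero]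
    refine ⟨⟨ψ, hψS⟩, ?_⟩
    ext b
    rw [hL]
    change ψ (Φ _) = _
    rw [hψ]
    have : q • b ^ (q - 1) • D b = 0 := by
      rw [← Nat.cast_smul_eq_nsmul K, hqK, zero_smul]
    rw [map_sub, Derivation.leibniz_pow, this, sub_zero]

/-- The space of derivations with values in a finite residue field has the dimension of the
cotangent space, or one less. -/
theorem finrank_derivation_add {A R K V : Type*} [CommRing A] [CommRing R] [Algebra A R]
    [Field K] [Finite K] [Algebra R K] [Algebra A K] [IsScalarTower A R K]
    [AddCommGroup V] [Module K V] [Module R V] [IsScalarTower R K V] [FiniteDimensional K V]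
    (hK : Function.Surjective (algebraMap R K))
    {P : Ideal R} (hP : RingHom.ker (algebraMap R K) = P)
    (Φ : P →ₗ[R] V) (hΦ : Function.Surjective Φ) (hker : ∀ y : P, Φ y = 0 ↔ (y : R) ∈ P ^ 2)
    {v : V} (hv : ∀ (a : A) (ha : algebraMap A R a ∈ P), ∃ c : K, Φ ⟨_, ha⟩ = c • v)
    {a₀ : A} (ha₀ : algebraMap A R a₀ ∈ P) (hav : Φ ⟨_, ha₀⟩ = v) :
    FiniteDimensional K (Derivation A R K) ∧
    (algebraMap A R a₀ ∈ P ^ 2 → Module.finrank K (Derivation A R K) = Module.finrank K V) ∧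
    (algebraMap A R a₀ ∉ P ^ 2 →
      Module.finrank K (Derivation A R K) + 1 = Module.finrank K V) := by
  obtain ⟨e⟩ := exists_cotangent_equiv_derivation hK hP Φ hΦ hker hv ha₀ hav
  have h := Subspace.finrank_add_finrank_dualAnnihilator_eq (Submodule.span K {v})
  have h0 := hker ⟨_, ha₀⟩
  rw [hav] at h0
  refine ⟨Module.Finite.equiv e, fun hmem => ?_, fun hmem => ?_⟩
  · rw [← e.finrank_eq, ← h, h0.2 hmem]
    simp
  · rw [← e.finrank_eq, ← h, finrank_span_singleton (fun h' => hmem (h0.1 h')), add_comm]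

/-! ### Tangent and cotangent spaces at a closed point -/

/-- The tangent space is the space of derivations into the residue field. -/
noncomputable def zariskiTangentSpaceEquivDerivation (A : Type*) {R : Type*} [CommRing A]
    [CommRing R] [Algebra A R] (P : PrimeSpectrum R) [P.asIdeal.IsMaximal] :
    ZariskiTangentSpace A P ≃ₗ[P.asIdeal.ResidueField]
      Derivation A R P.asIdeal.ResidueField :=
  LinearEquiv.extendScalarsOfSurjective P.asIdeal.algebraMap_residueField_surjective
    (((LinearMap.liftBaseChangeEquiv P.asIdeal.ResidueField).symm.restrictScalars R).trans
      (KaehlerDifferential.linearMapEquivDerivation A R))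

/-- The map from a maximal ideal to the cotangent space of the local ring. -/
noncomputable def toLocalCotangentSpace {R : Type*} [CommRing R] (P : PrimeSpectrum R) :
    P.asIdeal →ₗ[R] localCotangentSpace P :=
  (Ideal.mapCotangent P.asIdeal (IsLocalRing.maximalIdeal (Localization.AtPrime P.asIdeal))
    (Algebra.ofId R _) (by
      intro x hx
      exact (IsLocalization.AtPrime.to_map_mem_maximal_iff _ P.asIdeal x).2 hx)) ∘ₗ
    P.asIdeal.toCotangent

theorem toLocalCotangentSpace_eq_zero_iff {R : Type*} [CommRing R] (P : PrimeSpectrum R)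
    [P.asIdeal.IsMaximal] (y : P.asIdeal) :
    toLocalCotangentSpace P y = 0 ↔ (y : R) ∈ P.asIdeal ^ 2 := by
  rw [← IsLocalization.AtPrime.under_maximalIdeal_pow P.asIdeal
    (Localization.AtPrime P.asIdeal) 2]
  exact Ideal.toCotangent_eq_zero _ _

theorem toLocalCotangentSpace_surjective {R : Type*} [CommRing R] (P : PrimeSpectrum R)
    [hP : P.asIdeal.IsMaximal] : Function.Surjective (toLocalCotangentSpace P) := by
  intro w
  obtain ⟨⟨y, hy⟩, rfl⟩ := Ideal.toCotangent_surjective _ w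
  obtain ⟨a, s, rfl⟩ := IsLocalization.exists_mk'_eq P.asIdeal.primeCompl y
  have ha : a ∈ P.asIdeal :=
    (IsLocalization.AtPrime.mk'_mem_maximal_iff (Localization.AtPrime P.asIdeal) P.asIdeal a s).1 hy
  -- `u` inverts `s` modulo `P`, so `a / s` and `u * a` differ by a multiple of `c * (a / s)`, a
  -- product of two elements of the maximal ideal.
  obtain ⟨u, c, hc, h⟩ := hP.exists_inv s.2
  refine ⟨⟨u * a, P.asIdeal.mul_mem_left u ha⟩, ?_⟩
  refine (Ideal.toCotangent_eq _).2 ?_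
  change algebraMap R (Localization.AtPrime P.asIdeal) (u * a) - _ ∈ _
  have e : algebraMap R (Localization.AtPrime P.asIdeal) (u * a) - IsLocalization.mk' _ a s =
      - (algebraMap R (Localization.AtPrime P.asIdeal) c * IsLocalization.mk' _ a s) := by
    have h1 : algebraMap R (Localization.AtPrime P.asIdeal) (u * s + c) = 1 := by
      rw [h, map_one]
    have h2 := IsLocalization.mk'_spec (Localization.AtPrime P.asIdeal) a s
    rw [map_mul, ← h2]
    rw [map_add, map_mul] at h1
    linear_combination (IsLocalization.mk' (Localization.AtPrime P.asIdeal) a s) * h1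
  rw [e, pow_two]
  refine neg_mem (Ideal.mul_mem_mul ?_ hy)
  exact (IsLocalization.AtPrime.to_map_mem_maximal_iff _ P.asIdeal c).2 hc

instance {R : Type*} [CommRing R] (P : PrimeSpectrum R) :
    IsScalarTower R P.asIdeal.ResidueField (localCotangentSpace P) :=
  .of_algebraMap_smul fun r x => by
    rw [IsScalarTower.algebraMap_apply R (Localization.AtPrime P.asIdeal) P.asIdeal.ResidueField]
    refine (algebraMap_smul (R := Localization.AtPrime P.asIdeal) _ _ x).trans ?_
    exact algebraMap_smul _ r x

/-- The dimension of the relative tangent space at a point with finite residue field, over a base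
whose maximal ideal is generated by one element modulo `P ^ 2`. -/
theorem finrank_zariskiTangentSpace {A R : Type*} [CommRing A] [CommRing R] [Algebra A R]
    [IsNoetherianRing R] (P : PrimeSpectrum R) [P.asIdeal.IsMaximal] (hfin : Finite (R ⧸ P.asIdeal))
    {a₀ : A} (ha₀ : algebraMap A R a₀ ∈ P.asIdeal)
    (hgen : ∀ a : A, algebraMap A R a ∈ P.asIdeal →
      ∃ c : R, algebraMap A R a - c * algebraMap A R a₀ ∈ P.asIdeal ^ 2) :
    FiniteDimensional P.asIdeal.ResidueField (ZariskiTangentSpace A P) ∧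
    (algebraMap A R a₀ ∈ P.asIdeal ^ 2 →
      Module.finrank P.asIdeal.ResidueField (ZariskiTangentSpace A P) = embeddingDimension P) ∧
    (algebraMap A R a₀ ∉ P.asIdeal ^ 2 →
      Module.finrank P.asIdeal.ResidueField (ZariskiTangentSpace A P) + 1 =
        embeddingDimension P) := by
  have : IsNoetherianRing (Localization.AtPrime P.asIdeal) :=
    IsLocalization.isNoetherianRing P.asIdeal.primeCompl _ inferInstance
  have : Finite P.asIdeal.ResidueField :=
    Finite.of_surjective _ P.asIdeal.bijective_algebraMap_quotient_residueField.2
  let e := zariskiTangentSpaceEquivDerivation A P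
  have hv (a : A) (ha : algebraMap A R a ∈ P.asIdeal) : ∃ c : P.asIdeal.ResidueField,
      toLocalCotangentSpace P ⟨_, ha⟩ = c • toLocalCotangentSpace P ⟨_, ha₀⟩ := by
    obtain ⟨c, hc⟩ := hgen a ha
    refine ⟨algebraMap R _ c, ?_⟩
    rw [algebraMap_smul, ← map_smul, ← sub_eq_zero, ← map_sub, toLocalCotangentSpace_eq_zero_iff]
    exact hc
  obtain ⟨h1, h2, h3⟩ := finrank_derivation_add P.asIdeal.algebraMap_residueField_surjective
    P.asIdeal.ker_algebraMap_residueField (toLocalCotangentSpace P)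
    (toLocalCotangentSpace_surjective P) (toLocalCotangentSpace_eq_zero_iff P) hv ha₀ rfl
  rw [← e.finrank_eq] at h2 h3
  exact ⟨Module.Finite.equiv e.symm, h2, h3⟩

/-! ### Characters and the embedding of `ℤ[ξ] ⊗ R(G)` in `ℤ[ξ] ^ G` -/

section Characters

variable {G : Type*} [Group G] [Finite G]

/-- The eigenvalues are `n`-th roots of unity, hence powers of `ξ`, and the trace is their sum. -/
theorem trace_mem_of_pow_eq_one {V : Type*} [AddCommGroup V] [Module ℂ V] [FiniteDimensional ℂ V]
    {n : ℕ} [NeZero n] {ξ : ℂ} (hξ : IsPrimitiveRoot ξ n) {T : Module.End ℂ V} (hT : T ^ n = 1) :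
    LinearMap.trace ℂ V T ∈ Algebra.adjoin ℤ {ξ} := by
  rw [Module.End.trace_eq_sum_roots_charpoly_of_splits (IsAlgClosed.splits _)]
  refine Subalgebra.multiset_sum_mem _ fun μ hμ => ?_
  have hev : T.HasEigenvalue μ := by
    rw [Module.End.hasEigenvalue_iff_isRoot_charpoly]
    exact Polynomial.isRoot_of_mem_roots hμ
  obtain ⟨v, hv⟩ := hev.exists_hasEigenvector
  have h := hv.pow_apply n
  rw [hT, Module.End.one_apply] at h
  have h1 : μ ^ n = 1 := by
    have h2 : (μ ^ n - 1) • v = 0 := by rw [sub_smul, ← h, one_smul, sub_self]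
    exact sub_eq_zero.1 ((smul_eq_zero.1 h2).resolve_right hv.2)
  obtain ⟨i, -, rfl⟩ := hξ.eq_pow_of_pow_eq_one h1
  exact pow_mem (Algebra.self_mem_adjoin_singleton ℤ ξ) i

theorem apply_mem_adjoin_of_mem_representationRing {ξ : ℂ} (hξ : IsPrimitiveRoot ξ (Nat.card G))
    {f : G → ℂ} (hf : f ∈ representationRing G) (g : G) : f g ∈ Algebra.adjoin ℤ {ξ} := by
  have : NeZero (Nat.card G) := ⟨Nat.card_pos.ne'⟩
  change f ∈ AddSubgroup.closure (irreducibleCharacters G) at hf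
  induction hf using AddSubgroup.closure_induction with
  | mem x hx =>
    obtain ⟨d, ρ, -, rfl⟩ := hx
    refine trace_mem_of_pow_eq_one hξ ?_
    rw [← map_pow, pow_card_eq_one', map_one]
  | zero => exact zero_mem _
  | add x y _ _ hx hy => exact add_mem hx hy
  | neg x _ hx => exact neg_mem hx

/-- By orthonormality, pairing with the irreducible characters gives a dual system of functionals.
-/
theorem linearIndependent_irreducibleCharacters :
    LinearIndependent ℂ (Subtype.val : irreducibleCharacters G → G → ℂ) := by
  classical
  have : Fintype G := Fintype.ofFinite G
  have hcard : (Nat.card G : ℂ) ≠ 0 := Nat.cast_ne_zero.2 Nat.card_pos.ne'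
  have : Invertible (Nat.card G : ℂ) := invertibleOfNonzero hcard
  let F (χ : G → ℂ) : (G → ℂ) →ₗ[ℂ] ℂ :=
    (Nat.card G : ℂ)⁻¹ • ∑ g : G, χ g⁻¹ • LinearMap.proj g
  have hF (χ ψ : G → ℂ) : F χ ψ = (Nat.card G : ℂ)⁻¹ * ∑ g : G, ψ g * χ g⁻¹ := by
    simp [F, mul_comm]
  have horth (χ ψ : irreducibleCharacters G) : F χ ψ = if ψ = χ then 1 else 0 := by
    obtain ⟨_, d, ρ, hρ, rfl⟩ := χ
    obtain ⟨_, e, σ, hσ, rfl⟩ := ψ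
    rw [hF, Representation.char_orthonormal]
    by_cases h : Nonempty (Representation.Equiv ρ σ)
    · obtain ⟨φ⟩ := h
      rw [if_pos ⟨φ⟩, if_pos (Subtype.ext (Representation.char_iso φ).symm)]
    · rw [if_neg h, if_neg]
      -- Inequivalent irreducibles have distinct characters: otherwise one pairing would be both `0`
      -- and `1`.
      intro h'
      have h1 := Representation.char_orthonormal (k := ℂ) σ ρ
      rw [if_neg h] at h1
      have h2 := Representation.char_orthonormal (k := ℂ) σ σ
      rw [if_pos ⟨Representation.Equiv.refl σ⟩] at h2
      rw [← show σ.character = ρ.character from congrArg Subtype.val h', h2] at h1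
      exact one_ne_zero h1
  rw [linearIndependent_iff']
  intro s c hc χ hχ
  have h := congrArg (F χ) hc
  simpa [horth, hχ] using h

theorem span_irreducibleCharacters :
    Submodule.span ℤ (Set.range fun χ : irreducibleCharacters G =>
      (⟨χ, AddSubgroup.subset_closure χ.2⟩ : representationRing G)) = ⊤ := by
  rw [eq_top_iff]
  rintro ⟨f, hf⟩ -
  change f ∈ AddSubgroup.closure (irreducibleCharacters G) at hf
  induction hf using AddSubgroup.closure_induction with
  | mem x hx => exact Submodule.subset_span ⟨⟨x, hx⟩, rfl⟩
  | zero => exact zero_mem _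
  | add x y _ _ hx hy => exact add_mem hx hy
  | neg x _ hx => exact neg_mem hx

variable (G) in
/-- The irreducible characters form a basis of the representation ring. -/
noncomputable def irreducibleCharactersBasis :
    Module.Basis (irreducibleCharacters G) ℤ (representationRing G) :=
  Module.Basis.mk (v := fun χ : irreducibleCharacters G =>
      (⟨χ, AddSubgroup.subset_closure χ.2⟩ : representationRing G))
    (LinearIndependent.of_comp (representationRing G).subtype.toAddMonoidHom.toIntLinearMap
      (linearIndependent_irreducibleCharacters.restrict_scalars' ℤ))
    span_irreducibleCharacters.ge

theorem irreducibleCharactersBasis_apply (χ : irreducibleCharacters G) :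
    (irreducibleCharactersBasis G χ : G → ℂ) = χ := by
  simp [irreducibleCharactersBasis]

instance : Module.Finite ℤ (representationRing G) :=
  have : Finite (irreducibleCharacters G) :=
    linearIndependent_irreducibleCharacters.setFinite
  Module.Finite.of_basis (irreducibleCharactersBasis G)

/-- Evaluation of a virtual character at an element of the group. -/
noncomputable def representationRingEval {ξ : ℂ} (hξ : IsPrimitiveRoot ξ (Nat.card G)) (g : G) :
    representationRing G →ₐ[ℤ] Algebra.adjoin ℤ {ξ} :=
  (((Pi.evalRingHom (fun _ : G => ℂ) g).comp (representationRing G).subtype).codRestrict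
    (Algebra.adjoin ℤ {ξ}) fun f => apply_mem_adjoin_of_mem_representationRing hξ f.2 g).toIntAlgHom

/-- The extension of evaluation at all elements of the group by linearity over `ℤ[ξ]`. -/
noncomputable def extendedEval {ξ : ℂ} (hξ : IsPrimitiveRoot ξ (Nat.card G)) :
    extendedRepresentationRing G ξ →ₐ[Algebra.adjoin ℤ {ξ}] (G → Algebra.adjoin ℤ {ξ}) :=
  Algebra.TensorProduct.lift (Algebra.ofId _ _)
    (AlgHom.pi fun g => representationRingEval hξ g) fun _ _ => Commute.all _ _

/-- The basis elements `1 ⊗ χ` go to the characters themselves, which are independent over `ℂ` and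
so over `ℤ[ξ]`. -/
theorem extendedEval_injective {ξ : ℂ} (hξ : IsPrimitiveRoot ξ (Nat.card G)) :
    Function.Injective (extendedEval hξ) := by
  let b := Algebra.TensorProduct.basis (Algebra.adjoin ℤ {ξ}) (irreducibleCharactersBasis G)
  have hli : LinearIndependent (Algebra.adjoin ℤ {ξ}) (fun χ => extendedEval hξ (b χ)) := by
    refine LinearIndependent.of_comp
      (LinearMap.compLeft (Algebra.linearMap (Algebra.adjoin ℤ {ξ}) ℂ) G) ?_
    convert (linearIndependent_irreducibleCharacters (G := G)).restrict_scalars'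
      (Algebra.adjoin ℤ {ξ}) using 1
    funext χ g
    have h := congrFun (irreducibleCharactersBasis_apply χ) g
    simp only [b, Function.comp_apply, Algebra.TensorProduct.basis_apply, extendedEval,
      Algebra.TensorProduct.lift_tmul, map_one, one_mul]
    exact h
    rfl
  rw [← AlgHom.coe_toLinearMap, ← LinearMap.ker_eq_bot, LinearMap.ker_eq_bot']
  intro x hx
  rw [← b.linearCombination_repr x, Finsupp.apply_linearCombination] at hx
  have h0 := linearIndependent_iff.1 hli _ hx
  rw [← b.linearCombination_repr x, h0, map_zero]

end Characters

/-! ### Ramification in `ℤ[ξ]` -/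

section Cyclotomic

variable {n : ℕ} [NeZero n] {ξ : ℂ}

/-- `ξ` is the image of a primitive root `ζ` of `K`, so `ℤ[ξ]` is isomorphic to `ℤ[ζ]`, the ring of
integers of `K`. -/
theorem isDedekindDomain_adjoin_of_algHom {K : Type*} [Field K] [CharZero K]
    [IsCyclotomicExtension {n} ℚ K] (φ : K →ₐ[ℚ] ℂ) (hξ : IsPrimitiveRoot ξ n) :
    IsDedekindDomain (Algebra.adjoin ℤ {ξ} : Subalgebra ℤ ℂ) := by
  have : FiniteDimensional ℚ K := IsCyclotomicExtension.finiteDimensional {n} ℚ K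
  have hζ := IsCyclotomicExtension.zeta_spec n ℚ K
  obtain ⟨i, -, hi⟩ := (hζ.map_of_injective (f := φ) φ.injective).eq_pow_of_pow_eq_one
    hξ.pow_eq_one
  set ζ : K := IsCyclotomicExtension.zeta n ℚ K ^ i with hζdef
  have hφ : φ ζ = ξ := by rw [hζdef, map_pow, hi]
  have hζ' : IsPrimitiveRoot ζ n := IsPrimitiveRoot.of_map_of_injective (hφ ▸ hξ) φ.injective
  have hmap : (Algebra.adjoin ℤ {ζ}).map (φ.restrictScalars ℤ) = Algebra.adjoin ℤ {ξ} := by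
    rw [AlgHom.map_adjoin, Set.image_singleton]
    exact congrArg (fun z : ℂ => Algebra.adjoin ℤ {z}) hφ
  let e : (Algebra.adjoin ℤ {ξ} : Subalgebra ℤ ℂ) ≃ₐ[ℤ] (Algebra.adjoin ℤ {ζ} : Subalgebra ℤ K) :=
    ((Subalgebra.equivMapOfInjective _ (φ.restrictScalars ℤ) φ.injective).trans
      (Subalgebra.equivOfEq _ _ hmap)).symm
  have hint := IsCyclotomicExtension.Rat.isIntegralClosure_adjoin_singleton hζ'
  let _ : Algebra (Algebra.adjoin ℤ {ξ} : Subalgebra ℤ ℂ) K :=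
    ((algebraMap (Algebra.adjoin ℤ {ζ}) K).comp e.toRingEquiv.toRingHom).toAlgebra
  have : IsIntegralClosure (Algebra.adjoin ℤ {ξ} : Subalgebra ℤ ℂ) ℤ K := by
    refine ⟨hint.algebraMap_injective.comp e.injective, fun {x} => ?_⟩
    rw [hint.isIntegral_iff (x := x)]
    exact ⟨fun ⟨y, hy⟩ => ⟨e.symm y, by rw [← hy]; exact congrArg (algebraMap (Algebra.adjoin ℤ {ζ}) K) (e.apply_symm_apply y)⟩,
      fun ⟨y, hy⟩ => ⟨e y, hy⟩⟩
  exact IsIntegralClosure.isDedekindDomain ℤ ℚ K _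

theorem isDedekindDomain_adjoin (hξ : IsPrimitiveRoot ξ n) :
    IsDedekindDomain (Algebra.adjoin ℤ {ξ} : Subalgebra ℤ ℂ) := by
  have : IsCyclotomicExtension {n} ℚ (CyclotomicField n ℚ) := by
    have : NeZero (n : ℚ) := NeZero.charZero
    convert CyclotomicField.isCyclotomicExtension n ℚ
    · rfl
    · exact Subsingleton.elim _ _
  have : FiniteDimensional ℚ (CyclotomicField n ℚ) :=
    IsCyclotomicExtension.finiteDimensional {n} ℚ (CyclotomicField n ℚ)
  exact isDedekindDomain_adjoin_of_algHom (K := CyclotomicField n ℚ) IsAlgClosed.lift hξ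

theorem finite_adjoin (hξ : IsPrimitiveRoot ξ n) :
    Module.Finite ℤ (Algebra.adjoin ℤ {ξ} : Subalgebra ℤ ℂ) :=
  Module.Finite.iff_fg.2 (hξ.isIntegral (NeZero.pos n)).fg_adjoin_singleton

/-- A ring finite over the integers has finite quotients in positive characteristic. -/
theorem finite_quotient_of_natCast_mem {R : Type*} [CommRing R] [Module.Finite ℤ R] {P : Ideal R}
    {p : ℕ} (hp : p ≠ 0) (hpP : (p : R) ∈ P) : Finite (R ⧸ P) := by
  refine Module.finite_of_fg_torsion _ fun {x} => ?_
  obtain ⟨y, rfl⟩ := Ideal.Quotient.mk_surjective x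
  refine ⟨⟨(p : ℤ), mem_nonZeroDivisors_of_ne_zero (by exact_mod_cast hp)⟩, ?_⟩
  change (p : ℤ) • Ideal.Quotient.mk P y = 0
  rw [zsmul_eq_mul, ← map_intCast (Ideal.Quotient.mk P), ← map_mul, Ideal.Quotient.eq_zero_iff_mem]
  exact P.mul_mem_right _ (by simpa using hpP)

/-- A nonzero prime of a Dedekind domain is generated by one element modulo its square. -/
theorem exists_uniformizer {A : Type*} [CommRing A] [IsDedekindDomain A] {𝔭 : Ideal A}
    [h𝔭 : 𝔭.IsPrime] (h0 : 𝔭 ≠ ⊥) :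
    ∃ x ∈ 𝔭, x ∉ 𝔭 ^ 2 ∧ ∀ a ∈ 𝔭, ∃ d, a - d * x ∈ 𝔭 ^ 2 := by
  obtain ⟨x, hx, hx2⟩ := 𝔭.exists_mem_pow_notMem_pow_succ h0 h𝔭.ne_top 1
  refine ⟨x, by simpa using hx, hx2, fun a ha => ?_⟩
  obtain ⟨d, e, he, h⟩ := Ideal.exists_mul_add_mem_pow_succ h0 (i := 1) x a hx hx2 (by simpa using ha)
  exact ⟨d, by rwa [← h, mul_comm, add_sub_cancel_left]⟩

theorem natCast_dvd_of_intCast_mem {R : Type*} [CommRing R] {P : Ideal R} (hP : P ≠ ⊤) {p : ℕ}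
    (hp : p.Prime) (hpP : (p : R) ∈ P) {a : ℤ} (ha : (a : R) ∈ P) : (p : ℤ) ∣ a := by
  by_contra hcon
  obtain ⟨u, v, huv⟩ := ((Nat.prime_iff_prime_int.1 hp).coprime_iff_not_dvd).2 hcon
  refine hP ((Ideal.eq_top_iff_one P).2 ?_)
  have h := congrArg (Int.cast : ℤ → R) huv
  push_cast at h
  rw [← h]
  exact add_mem (P.mul_mem_left _ hpP) (P.mul_mem_left _ ha)

/-- The absolute tangent space at a closed point of residue characteristic `p`. -/
theorem finrank_zariskiTangentSpace_int {R : Type*} [CommRing R] [Algebra ℤ R] [IsNoetherianRing R]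
    (P : PrimeSpectrum R) [P.asIdeal.IsMaximal] (hfin : Finite (R ⧸ P.asIdeal)) {p : ℕ}
    (hp : p.Prime) (hpP : (p : R) ∈ P.asIdeal) :
    FiniteDimensional P.asIdeal.ResidueField (ZariskiTangentSpace ℤ P) ∧
    ((p : R) ∈ P.asIdeal ^ 2 →
      Module.finrank P.asIdeal.ResidueField (ZariskiTangentSpace ℤ P) = embeddingDimension P) ∧
    ((p : R) ∉ P.asIdeal ^ 2 →
      Module.finrank P.asIdeal.ResidueField (ZariskiTangentSpace ℤ P) + 1 =
        embeddingDimension P) := by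
  have h := finrank_zariskiTangentSpace (A := ℤ) P hfin (a₀ := (p : ℤ)) (by simpa using hpP)
    fun a ha => by
      obtain ⟨k, rfl⟩ := natCast_dvd_of_intCast_mem P.2.ne_top hp hpP (a := a) (by simpa using ha)
      exact ⟨(k : R), by simp [mul_comm]⟩
  simpa using h

/-- Some power of `μ - 1` is divisible by `p`, so `μ - 1 ∈ 𝔭`; and `(μ - 1) ^ 2` divides `p`. The
second point fails for `μ = -1`, hence the exclusion of `m = 2`. -/
theorem natCast_mem_sq_of_isPrimitiveRoot {A : Type*} [CommRing A] [IsDomain A]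
    {𝔭 : Ideal A} [𝔭.IsPrime] {p m : ℕ} (hp : p.Prime) (hp𝔭 : (p : A) ∈ 𝔭)
    (hm : m = p ∨ m = 4 ∧ p = 2) (hm2 : m ≠ 2) {μ : A} (hμ : IsPrimitiveRoot μ m) :
    (p : A) ∈ 𝔭 ^ 2 := by
  have hmem : μ - 1 ∈ 𝔭 := by
    rcases hm with rfl | ⟨rfl, rfl⟩
    · obtain ⟨r, hr⟩ := exists_add_pow_prime_eq hp (μ - 1) (1 : A)
      rw [sub_add_cancel, hμ.pow_eq_one, one_pow] at hr
      refine Ideal.IsPrime.mem_of_pow_mem ‹_› m ?_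
      have : (μ - 1) ^ m = - (m * ((μ - 1) * 1 * r)) := by linear_combination -hr
      rw [this]
      exact neg_mem (𝔭.mul_mem_right _ hp𝔭)
    · refine Ideal.IsPrime.mem_of_pow_mem ‹_› 4 ?_
      have : (μ - 1) ^ 4 = (2 : ℕ) * (1 - 2 * μ + 3 * μ ^ 2 - 2 * μ ^ 3) := by
        push_cast
        linear_combination hμ.pow_eq_one
      rw [this]
      exact 𝔭.mul_mem_right _ hp𝔭
  rcases hm with rfl | ⟨rfl, rfl⟩
  · have h2 : 2 < m := lt_of_le_of_ne hp.two_le (Ne.symm hm2)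
    obtain ⟨z, -, hz⟩ := hμ.self_sub_one_pow_dvd_order h2
    rw [hz]
    exact Ideal.mul_mem_left _ _ (Ideal.pow_mem_pow hmem 2)
  · have h1 : μ ^ 2 + 1 = 0 := by
      have h := hμ.pow_eq_one
      have h' : μ ^ 2 - 1 ≠ 0 := sub_ne_zero.2 (hμ.pow_ne_one_of_pos_of_lt (by norm_num) (by norm_num))
      refine (mul_eq_zero.1 (?_ : (μ ^ 2 - 1) * (μ ^ 2 + 1) = 0)).resolve_left h'
      linear_combination h
    -- From `μ ^ 2 = -1` follows `(μ - 1) ^ 2 = -2 * μ`.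
    have : ((2 : ℕ) : A) = μ * (μ - 1) ^ 2 := by
      push_cast
      linear_combination (2 - μ) * h1
    rw [this]
    exact Ideal.mul_mem_left _ _ (Ideal.pow_mem_pow hmem 2)

theorem natCast_mem_sq_of_dvd (hξ : IsPrimitiveRoot ξ n)
    {𝔭 : Ideal (Algebra.adjoin ℤ {ξ} : Subalgebra ℤ ℂ)} [𝔭.IsPrime] {p : ℕ} (hp : p.Prime)
    (hp𝔭 : (p : (Algebra.adjoin ℤ {ξ} : Subalgebra ℤ ℂ)) ∈ 𝔭) (h : p ∣ n ∧ (p ≠ 2 ∨ 4 ∣ n)) :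
    (p : (Algebra.adjoin ℤ {ξ} : Subalgebra ℤ ℂ)) ∈ 𝔭 ^ 2 := by
  have hn : 0 < n := NeZero.pos n
  let x : (Algebra.adjoin ℤ {ξ} : Subalgebra ℤ ℂ) := ⟨ξ, Algebra.self_mem_adjoin_singleton ℤ ξ⟩
  have hx : IsPrimitiveRoot x n :=
    IsPrimitiveRoot.of_map_of_injective (f := (Algebra.adjoin ℤ {ξ}).val) hξ
      Subtype.val_injective
  by_cases h2 : p = 2
  · subst h2
    obtain ⟨m, hm⟩ := h.2.resolve_left (by simp)
    exact natCast_mem_sq_of_isPrimitiveRoot hp hp𝔭 (m := 4) (Or.inr ⟨rfl, rfl⟩) (by norm_num)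
      (hx.pow hn (hm.trans (mul_comm _ _)))
  · obtain ⟨m, hm⟩ := h.1
    exact natCast_mem_sq_of_isPrimitiveRoot hp hp𝔭 (Or.inl rfl) h2
      (hx.pow hn (hm.trans (mul_comm _ _)))

/-- Differentiating `x ^ m = ±1` gives `m * x ^ (m - 1) * D x = 0`, and `D` is determined by `D x`.
-/
theorem subsingleton_derivation_of_pow_eq {S A M : Type*} [CommRing S] [CommRing A] [Algebra S A]
    [AddCommGroup M] [Module A M] {_ : Module S M} {x : A} {m : ℕ} (hx : Algebra.adjoin S {x} = ⊤)
    (hm : x ^ m = 1 ∨ x ^ m = -1) (hM : ∀ z : M, ((m : A) * x ^ (m - 1)) • z = 0 → z = 0) :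
    Subsingleton (Derivation S A M) := by
  have hD (D : Derivation S A M) : D x = 0 := by
    refine hM _ ?_
    rw [mul_smul, Nat.cast_smul_eq_nsmul, ← Derivation.leibniz_pow]
    rcases hm with h | h <;> simp [h]
  exact ⟨fun D D' => Derivation.ext_of_adjoin_eq_top {x} hx (by rintro _ rfl; rw [hD, hD])⟩

/-- Here `m * x ^ (m - 1)` is nonzero modulo `P`, so the absolute tangent space vanishes. If `p`
were in `P ^ 2`, the cotangent space would have the same dimension `0`, contradicting the existence
of a uniformizer. -/
theorem not_natCast_mem_sq_of_pow_eq {A : Type*} [CommRing A] [IsDedekindDomain A] [CharZero A]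
    [Module.Finite ℤ A] (P : PrimeSpectrum A) {p m : ℕ} (hp : p.Prime)
    (hpP : (p : A) ∈ P.asIdeal) {x : A} (hx : Algebra.adjoin ℤ {x} = ⊤) (hpm : ¬ p ∣ m)
    (hm : x ^ m = 1 ∨ x ^ m = -1) : (p : A) ∉ P.asIdeal ^ 2 := by
  intro hmem
  have hfin := finite_quotient_of_natCast_mem hp.ne_zero hpP
  have hp0 : (p : A) ≠ 0 := Nat.cast_ne_zero.2 hp.ne_zero
  have h0 : P.asIdeal ≠ ⊥ := fun h => hp0 (by rw [h] at hpP; simpa using hpP)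
  have hmax : P.asIdeal.IsMaximal := P.2.isMaximal h0
  have hk : (m : A) ∉ P.asIdeal := fun hmem => hpm <| by
    exact_mod_cast natCast_dvd_of_intCast_mem P.2.ne_top hp hpP (a := m) (by simpa using hmem)
  have hxu : IsUnit x := by
    have hm0 : m ≠ 0 := fun h => hpm (by simp [h])
    refine (isUnit_pow_iff hm0).1 ?_
    rcases hm with h | h <;> simp [h]
  have hxm : (m : A) * x ^ (m - 1) ∉ P.asIdeal := fun h =>
    (P.2.mem_or_mem h).elim hk fun h' => P.2.ne_top (P.asIdeal.eq_top_of_isUnit_mem h' (hxu.pow _))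
  have hM (z : P.asIdeal.ResidueField) (hz : ((m : A) * x ^ (m - 1)) • z = 0) : z = 0 := by
    rw [Algebra.smul_def] at hz
    exact (mul_eq_zero.1 hz).resolve_left fun h => hxm (Ideal.algebraMap_residueField_eq_zero.1 h)
  have hnoeth : IsNoetherianRing A := inferInstance
  have key := (finrank_zariskiTangentSpace_int P hfin hp hpP).2.1 hmem
  have : Subsingleton (ZariskiTangentSpace ℤ P) :=
    (zariskiTangentSpaceEquivDerivation ℤ P).toEquiv.subsingleton_congr.2
      (subsingleton_derivation_of_pow_eq hx hm hM)
  have : IsNoetherianRing (Localization.AtPrime P.asIdeal) :=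
    IsLocalization.isNoetherianRing P.asIdeal.primeCompl _ inferInstance
  rw [Module.finrank_zero_of_subsingleton] at key
  have hsub : Subsingleton (localCotangentSpace P) :=
    (Module.finrank_zero_iff (R := P.asIdeal.ResidueField)).1 key.symm
  obtain ⟨y, hy, hy2, -⟩ := exists_uniformizer h0
  exact hy2 ((toLocalCotangentSpace_eq_zero_iff P ⟨y, hy⟩).1 (Subsingleton.elim _ _))

theorem not_natCast_mem_sq (hξ : IsPrimitiveRoot ξ n)
    {𝔭 : Ideal (Algebra.adjoin ℤ {ξ} : Subalgebra ℤ ℂ)} [h𝔭 : 𝔭.IsPrime] {p : ℕ} (hp : p.Prime)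
    (hp𝔭 : (p : (Algebra.adjoin ℤ {ξ} : Subalgebra ℤ ℂ)) ∈ 𝔭)
    (h : ¬ p ∣ n ∨ (p = 2 ∧ ¬ 4 ∣ n)) :
    (p : (Algebra.adjoin ℤ {ξ} : Subalgebra ℤ ℂ)) ∉ 𝔭 ^ 2 := by
  have := isDedekindDomain_adjoin hξ
  have := finite_adjoin hξ
  let x : (Algebra.adjoin ℤ {ξ} : Subalgebra ℤ ℂ) := ⟨ξ, Algebra.self_mem_adjoin_singleton ℤ ξ⟩
  have hex : ∃ m : ℕ, ¬ p ∣ m ∧ (x ^ m = 1 ∨ x ^ m = -1) := by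
    by_cases hpn : p ∣ n
    -- For `n = 2 * m` with `m` odd, `x ^ m` squares to `1` in a domain, so it is `±1`.
    · obtain ⟨rfl, h4⟩ := h.resolve_left (not_not.2 hpn)
      obtain ⟨m, hm⟩ := hpn
      refine ⟨m, fun ⟨k, hk⟩ => h4 ⟨k, by rw [hm, hk]; ring⟩, ?_⟩
      rw [← mul_self_eq_one_iff, ← pow_add, ← two_mul, ← hm]
      exact Subtype.ext hξ.pow_eq_one
    · exact ⟨n, hpn, Or.inl (Subtype.ext hξ.pow_eq_one)⟩
  obtain ⟨m, hpm, hm⟩ := hex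
  refine not_natCast_mem_sq_of_pow_eq ⟨𝔭, h𝔭⟩ hp hp𝔭 (x := x) ?_ hpm hm
  have hx : ({x} : Set (Algebra.adjoin ℤ {ξ} : Subalgebra ℤ ℂ)) = (↑) ⁻¹' ({ξ} : Set ℂ) := by
    ext y
    simp [x, Subtype.ext_iff]
  rw [hx]
  exact Algebra.adjoin_adjoin_coe_preimage

end Cyclotomic

/-! ### Rings between a Dedekind domain and a finite power of it; conclusion -/

theorem isMaximal_of_finite_quotient {R : Type*} [CommRing R] {P : Ideal R} [P.IsPrime]
    (h : Finite (R ⧸ P)) : P.IsMaximal :=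
  have := Finite.isField_of_domain (R ⧸ P)
  Ideal.Quotient.maximal_of_isField P this

/-- Every prime of a ring between `A` and a finite power of `A` is the inverse image of a prime
of `A` under one of the projections. -/
theorem exists_comap_eval_eq {ι A B : Type*} [Finite ι] [CommRing A] [CommRing B] [Algebra A B]
    (f : B →ₐ[A] (ι → A)) (hf : Function.Injective f) (P : PrimeSpectrum B) :
    ∃ (i : ι) (𝔭 : PrimeSpectrum A),
      𝔭.asIdeal.comap ((Pi.evalAlgHom A (fun _ : ι => A) i).comp f) = P.asIdeal := by
  let _ : Algebra B (ι → A) := f.toRingHom.toAlgebra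
  have : IsScalarTower A B (ι → A) := .of_algebraMap_eq fun x => (f.commutes x).symm
  -- The power `ι → A` is integral over `A`, hence over `B`, so lying over applies; a prime of a
  -- finite product comes from one factor.
  have : Algebra.IsIntegral B (ι → A) := Algebra.IsIntegral.tower_top A
  have : FaithfulSMul B (ι → A) := (faithfulSMul_iff_algebraMap_injective _ _).2 hf
  obtain ⟨Q, rfl⟩ := Algebra.IsIntegral.comap_surjective B (ι → A) P
  obtain ⟨i, 𝔭, rfl⟩ := PrimeSpectrum.exists_comap_evalRingHom_eq Q
  exact ⟨i, 𝔭, rfl⟩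

/-- A retraction onto the base ring detects membership in the square of a prime. -/
theorem algebraMap_mem_sq_iff {A B : Type*} [CommRing A] [CommRing B] [Algebra A B]
    (f : B →ₐ[A] A) (𝔭 : Ideal A) (a : A) :
    algebraMap A B a ∈ (𝔭.comap f) ^ 2 ↔ a ∈ 𝔭 ^ 2 := by
  have h : (𝔭 ^ 2).map (algebraMap A B) ≤ (𝔭.comap f) ^ 2 := by
    rw [Ideal.map_pow]
    refine Ideal.pow_right_mono (Ideal.map_le_iff_le_comap.2 fun x hx => ?_) 2
    simpa using hx
  refine ⟨fun ha => ?_, fun ha => h (Ideal.mem_map_of_mem _ ha)⟩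
  have := Ideal.le_comap_pow f 2 ha
  simpa using this

/-- Tangent spaces of a ring between a Dedekind domain `A` and a finite power of `A`. -/
theorem finrank_tangentSpaces_of_injective {ι A B : Type*} [Finite ι] [CommRing A]
    [IsDedekindDomain A] [CharZero A] [CommRing B] [IsNoetherianRing B] [Algebra A B]
    [Algebra ℤ B] (f : B →ₐ[A] (ι → A)) (hf : Function.Injective f)
    (P : PrimeSpectrum B) (hfin : Finite (B ⧸ P.asIdeal)) {p : ℕ}
    (hp : p.Prime) (hpP : (p : B) ∈ P.asIdeal) {c : Prop}
    (hc : ∀ 𝔭 : Ideal A, 𝔭.IsPrime → (p : A) ∈ 𝔭 → ((p : A) ∈ 𝔭 ^ 2 ↔ c)) :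
    (FiniteDimensional P.asIdeal.ResidueField (ZariskiTangentSpace A P) ∧
      FiniteDimensional P.asIdeal.ResidueField (ZariskiTangentSpace ℤ P) ∧
      FiniteDimensional P.asIdeal.ResidueField (localCotangentSpace P)) ∧
    (c →
      Module.finrank P.asIdeal.ResidueField (ZariskiTangentSpace A P) + 1 =
          Module.finrank P.asIdeal.ResidueField (ZariskiTangentSpace ℤ P) ∧
        Module.finrank P.asIdeal.ResidueField (ZariskiTangentSpace ℤ P) =
          embeddingDimension P) ∧
    (¬ c →
      Module.finrank P.asIdeal.ResidueField (ZariskiTangentSpace A P) =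
          Module.finrank P.asIdeal.ResidueField (ZariskiTangentSpace ℤ P) ∧
        (Module.finrank P.asIdeal.ResidueField (ZariskiTangentSpace ℤ P) : ℤ) =
          (embeddingDimension P : ℤ) - 1) ∧
    (c ↔ (p : B) ∈ P.asIdeal ^ 2) := by
  have hmax : P.asIdeal.IsMaximal := isMaximal_of_finite_quotient hfin
  have : IsNoetherianRing (Localization.AtPrime P.asIdeal) :=
    IsLocalization.isNoetherianRing P.asIdeal.primeCompl _ inferInstance
  obtain ⟨i, 𝔭, hP⟩ := exists_comap_eval_eq f hf P
  have hmem (a : A) : algebraMap A B a ∈ P.asIdeal ↔ a ∈ 𝔭.asIdeal := by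
    rw [← hP, Ideal.mem_comap, AlgHom.commutes, Algebra.algebraMap_self, RingHom.id_apply]
  have hmem2 (a : A) : algebraMap A B a ∈ P.asIdeal ^ 2 ↔ a ∈ 𝔭.asIdeal ^ 2 := by
    rw [← hP, algebraMap_mem_sq_iff]
  have hp𝔭 : (p : A) ∈ 𝔭.asIdeal := by rwa [← hmem, map_natCast]
  have hcP : c ↔ (p : B) ∈ P.asIdeal ^ 2 := by
    rw [← hc 𝔭.asIdeal 𝔭.2 hp𝔭, ← hmem2, map_natCast]
  have h0 : 𝔭.asIdeal ≠ ⊥ := fun h => by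
    rw [h] at hp𝔭
    exact hp.ne_zero (Nat.cast_eq_zero.1 ((Submodule.mem_bot _).1 hp𝔭))
  obtain ⟨x, hx, hx2, hxgen⟩ := exists_uniformizer h0
  obtain ⟨hA1, -, hA2⟩ := finrank_zariskiTangentSpace P hfin (a₀ := x) ((hmem x).2 hx)
    fun a ha => by
      obtain ⟨d, hd⟩ := hxgen a ((hmem a).1 ha)
      exact ⟨algebraMap _ _ d, by rwa [← map_mul, ← map_sub, hmem2]⟩
  obtain ⟨hZ1, hZ2, hZ3⟩ := finrank_zariskiTangentSpace_int P hfin hp hpP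
  -- The uniformizer stays outside `P ^ 2`, so over `A` the dimension drops by one in both cases;
  -- only the drop over `ℤ` depends on `c`.
  replace hA2 := hA2 (fun h => hx2 ((hmem2 x).1 h))
  refine ⟨⟨hA1, hZ1, inferInstance⟩, fun h => ?_, fun h => ?_, hcP⟩
  · have := hZ2 (hcP.1 h)
    exact ⟨hA2.trans this.symm, this⟩
  · have := hZ3 (fun h' => h (hcP.2 h'))
    omega

theorem finite_extendedRepresentationRing {G : Type*} [Group G] [Finite G] {ξ : ℂ}
    (hξ : IsPrimitiveRoot ξ (Nat.card G)) :
    Module.Finite ℤ (extendedRepresentationRing G ξ) := by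
  have : NeZero (Nat.card G) := ⟨Nat.card_pos.ne'⟩
  have := finite_adjoin hξ
  convert Module.Finite.tensorProduct ℤ (Algebra.adjoin ℤ {ξ} : Subalgebra ℤ ℂ)
    (representationRing G)
  · rfl
  · exact Subsingleton.elim _ _

theorem mainTheorem1 (G : Type*) [Group G] [Finite G] (n : ℕ) (hn : Nat.card G = n)
    (ξ : ℂ) (hξ : IsPrimitiveRoot ξ n)
    (P : PrimeSpectrum (extendedRepresentationRing G ξ))
    (p : ℕ) (hp : p.Prime) (hpP : (p : extendedRepresentationRing G ξ) ∈ P.asIdeal) :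
    -- all the spaces in question are finite-dimensional
    (FiniteDimensional P.asIdeal.ResidueField (ZariskiTangentSpace (Algebra.adjoin ℤ {ξ}) P) ∧
      FiniteDimensional P.asIdeal.ResidueField (ZariskiTangentSpace ℤ P) ∧
      FiniteDimensional P.asIdeal.ResidueField (localCotangentSpace P)) ∧
    -- first case
    (p ∣ n ∧ (p ≠ 2 ∨ 4 ∣ n) →
      Module.finrank P.asIdeal.ResidueField (ZariskiTangentSpace (Algebra.adjoin ℤ {ξ}) P) + 1 =
          Module.finrank P.asIdeal.ResidueField (ZariskiTangentSpace ℤ P) ∧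
        Module.finrank P.asIdeal.ResidueField (ZariskiTangentSpace ℤ P) =
          embeddingDimension P) ∧
    -- second case
    (¬ p ∣ n ∨ (p = 2 ∧ ¬ 4 ∣ n) →
      Module.finrank P.asIdeal.ResidueField (ZariskiTangentSpace (Algebra.adjoin ℤ {ξ}) P) =
          Module.finrank P.asIdeal.ResidueField (ZariskiTangentSpace ℤ P) ∧
        (Module.finrank P.asIdeal.ResidueField (ZariskiTangentSpace ℤ P) : ℤ) =
          (embeddingDimension P : ℤ) - 1) ∧
    -- the first case is the one in which `p` lies in the square of the ideal `P`
    ((p ∣ n ∧ (p ≠ 2 ∨ 4 ∣ n)) ↔ (p : extendedRepresentationRing G ξ) ∈ P.asIdeal ^ 2) := by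
  subst hn
  have : NeZero (Nat.card G) := ⟨Nat.card_pos.ne'⟩
  have := isDedekindDomain_adjoin hξ
  have := finite_extendedRepresentationRing hξ
  have : IsNoetherianRing (extendedRepresentationRing G ξ) := IsNoetherianRing.of_finite ℤ _
  have hneg : ¬ (p ∣ Nat.card G ∧ (p ≠ 2 ∨ 4 ∣ Nat.card G)) ↔
      ¬ p ∣ Nat.card G ∨ (p = 2 ∧ ¬ 4 ∣ Nat.card G) := by
    tauto
  -- The ramification condition is the same for all primes of `ℤ[ξ]` above `p`, so it can serve as
  -- `c`.
  have h := finrank_tangentSpaces_of_injective (extendedEval hξ) (extendedEval_injective hξ) P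
    (finite_quotient_of_natCast_mem hp.ne_zero hpP) hp hpP
    (c := p ∣ Nat.card G ∧ (p ≠ 2 ∨ 4 ∣ Nat.card G)) fun 𝔭 h𝔭 hp𝔭 =>
      ⟨fun h => by
        by_contra hcon
        exact not_natCast_mem_sq hξ hp hp𝔭 (hneg.1 hcon) h, natCast_mem_sq_of_dvd hξ hp hp𝔭⟩
  rwa [hneg] at h
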